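/- Let $d\ge 1$ be an integer, let $K=\{0\}\subset\mathbf R^d$ and $\Omega=\mathbf R^d\setminus K$, and write $d_\Gamma(x)=\inf_{y\notin\Omega}|x-y|$ for the Euclidean distance of $x\in\Omega$ to the boundary of $\Omega$ (so $d_\Gamma(x)=|x|$). Let $c_\Omega=c\circ d_\Gamma$ with $c(s)=s^{\delta}(1+s)^{\delta'-\delta}$, where $\delta=\delta'\in[0,2)$ (so $c(s)=s^\delta$), and let $H\varphi=-\sum_{k=1}^d\partial_k(c_\Omega\,\partial_k\varphi)$ for $\varphi\in C_c^2(\Omega)$, the real-valued $C^2$-functions with compact support in $\Omega$. For $p>1$ let $$\nu_p(\Omega)=\inf\Big\{\int_\Omega|H\varphi|^p\Big/\int_\Omega c_\Omega^{\,p}\,d_\Gamma^{-2p}\,|\varphi|^p:\ \varphi\in C_c^2(\Omega),\ \varphi\neq0\Big\}$$ be the optimal constant in the Rellich inequality $\int_\Omega|H\varphi|^p\ge \nu\int_\Omega|c_\Omega\, d_\Gamma^{-2}\varphi|^p$, $\varphi\in C_c^2(\Omega)$. Then $$\nu_p(\Omega)=\left(\frac{(p-1)\,d\,(d+p\delta-2p)}{p^2}\right)^p$$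 for every $p>1$ with $d+p\delta-2p>0$. -/

import Mathlib

open MeasureTheory

noncomputable section

/-- `d_Γ`, the Euclidean distance from `x ∈ Ω` to the boundary of `Ω`,
`d_Γ(x) = inf {|x - y| : y ∉ Ω}`. -/
def boundaryDist {d : ℕ} (Ω : Set (EuclideanSpace ℝ (Fin d))) (x : EuclideanSpace ℝ (Fin d)) : ℝ :=
  Metric.infDist x Ωᶜ

/-- The coefficient function `c(s) = s ^ δ (1 + s) ^ (δ' - δ)` on `(0, ∞)`. -/
def coeff (δ δ' s : ℝ) : ℝ := s ^ δ * (1 + s) ^ (δ' - δ)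

/-- The weight `c_Ω = c ∘ d_Γ`. -/
def weight {d : ℕ} (Ω : Set (EuclideanSpace ℝ (Fin d))) (δ δ' : ℝ)
    (x : EuclideanSpace ℝ (Fin d)) : ℝ :=
  coeff δ δ' (boundaryDist Ω x)

/-- The partial derivative `∂ₖ f` on `ℝᵈ`. -/
def partialDeriv {d : ℕ} (k : Fin d) (f : EuclideanSpace ℝ (Fin d) → ℝ)
    (x : EuclideanSpace ℝ (Fin d)) : ℝ :=
  fderiv ℝ f x (EuclideanSpace.single k 1)

/-- The operator `H φ = -div (c_Ω ∇φ) = -∑ₖ ∂ₖ (c_Ω ∂ₖ φ)`. -/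
def weightedOp {d : ℕ} (Ω : Set (EuclideanSpace ℝ (Fin d))) (δ δ' : ℝ)
    (φ : EuclideanSpace ℝ (Fin d) → ℝ) (x : EuclideanSpace ℝ (Fin d)) : ℝ :=
  -∑ k : Fin d, partialDeriv k (fun y => weight Ω δ δ' y * partialDeriv k φ y) x

/-- `C_c²(Ω)`: real functions of class `C²` whose support is a compact subset of `Ω`
(extended by zero to `ℝᵈ`). -/
def TestFunctions {d : ℕ} (Ω : Set (EuclideanSpace ℝ (Fin d))) :
    Set (EuclideanSpace ℝ (Fin d) → ℝ) :=
  {φ | ContDiff ℝ 2 φ ∧ HasCompactSupport φ ∧ tsupport φ ⊆ Ω}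

/-- The optimal Rellich constant
`ν_p(Ω) = inf { ∫_Ω |Hφ|^p / ∫_Ω c_Ω^p d_Γ^(-2p) |φ|^p : 0 ≠ φ ∈ C_c²(Ω) }`. -/
def rellichConstant {d : ℕ} (Ω : Set (EuclideanSpace ℝ (Fin d))) (δ δ' p : ℝ) : ℝ :=
  sInf {r : ℝ | ∃ φ ∈ TestFunctions Ω, φ ≠ 0 ∧
    r = (∫ x in Ω, |weightedOp Ω δ δ' φ x| ^ p) /
      ∫ x in Ω, weight Ω δ δ' x ^ p * boundaryDist Ω x ^ (-2 * p) * |φ x| ^ p}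

end

/-! Write A = d + pδ - 2p and C = (p-1)dA/p². The power u = |x|^(-A/p) satisfies Hu = C|x|^(δ-2)u
and turns both integrands into multiples of |x|^(-d). It is thus a formal extremal, excluded only by
logarithmic divergence at 0 and ∞.

Lower bound (`rellich_inequality`): pair Hφ with |x|^((δ-2)(p-1)) |φ|^(p-2) φ and integrate by
parts. Young's inequality splits off |Hφ|^p, and Cauchy–Schwarz replaces |x|²|∇φ|² by (x·∇φ)².
Adding a multiple of the divergence of |x|^(p(δ-2)) |φ|^p x completes a square and leaves exactly C.
All of this is one pointwise inequality modulo divergences, `rellich_pointwise`. Since |φ|^(p-2) φ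
need not be C¹ when p < 2, it is replaced by (φ²+e)^(p/2-1) φ, and e → 0 at the end.

Upper bound (`rellichConstant_le`): cut the extremal off slowly in the logarithmic scale, |x|^(-A/p)
η(ε log|x|). The measure |x|^(-d) dx becomes a multiple of dt with t = log|x|, each derivative of
the cutoff costs a factor ε, and the quotient tends to C^p. -/

theorem boundaryDist_compl_zero {d : ℕ} (x : EuclideanSpace ℝ (Fin d)) :
    boundaryDist {0}ᶜ x = ‖x‖ := by
  simp [boundaryDist, Metric.infDist_singleton]

theorem weight_compl_zero {d : ℕ} (δ : ℝ) (x : EuclideanSpace ℝ (Fin d)) :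
    weight {0}ᶜ δ δ x = ‖x‖ ^ δ := by
  simp [weight, coeff, boundaryDist_compl_zero]

theorem weightedOp_compl_zero {d : ℕ} (δ : ℝ) (φ : EuclideanSpace ℝ (Fin d) → ℝ)
    (x : EuclideanSpace ℝ (Fin d)) :
    weightedOp {0}ᶜ δ δ φ x =
      -∑ k, partialDeriv k (fun y => ‖y‖ ^ δ * partialDeriv k φ y) x := by
  simp only [weightedOp, weight_compl_zero]

/-! ### Partial derivatives of radial powers and integration by parts -/

section Calculus

variable {d : ℕ} {x : EuclideanSpace ℝ (Fin d)} (k : Fin d)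

theorem hasFDerivAt_norm_rpow_of_ne_zero (hx : x ≠ 0) (a : ℝ) :
    HasFDerivAt (fun y : EuclideanSpace ℝ (Fin d) => ‖y‖ ^ a)
      ((a * ‖x‖ ^ (a - 2)) • innerSL ℝ x) x := by
  have h0 : 0 < ‖x‖ := norm_pos_iff.2 hx
  have h1 := ((hasStrictFDerivAt_norm_sq x).hasFDerivAt).rpow_const (p := a / 2)
    (Or.inl (pow_pos h0 2).ne')
  have e1 : ∀ y : EuclideanSpace ℝ (Fin d), ∀ c : ℝ, (‖y‖ ^ 2) ^ c = ‖y‖ ^ (2 * c) := fun y c => by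
    rw [← Real.rpow_natCast, ← Real.rpow_mul (norm_nonneg y)]; norm_num
  simp only [e1] at h1
  rw [mul_div_cancel₀ a two_ne_zero] at h1
  have e2 : (a * ‖x‖ ^ (a - 2)) • innerSL ℝ x =
      (a / 2 * ‖x‖ ^ (2 * (a / 2 - 1))) • 2 • innerSL ℝ x := by
    ext v
    simp only [_root_.smul_apply, smul_eq_mul, nsmul_eq_mul]
    rw [show 2 * (a / 2 - 1) = a - 2 by ring]
    push_cast; ring
  rw [e2]
  exact h1

theorem contDiffAt_norm_rpow (hx : x ≠ 0) (a : ℝ) {n : WithTop ℕ∞} :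
    ContDiffAt ℝ n (fun y : EuclideanSpace ℝ (Fin d) => ‖y‖ ^ a) x :=
  (contDiffAt_norm ℝ hx).rpow_const_of_ne (norm_ne_zero_iff.2 hx)

theorem partialDeriv_norm_rpow (hx : x ≠ 0) (a : ℝ) :
    partialDeriv k (fun y => ‖y‖ ^ a) x = a * ‖x‖ ^ (a - 2) * x k := by
  rw [partialDeriv, (hasFDerivAt_norm_rpow_of_ne_zero hx a).fderiv]
  simp [EuclideanSpace.inner_single_right]

theorem partialDeriv_mul {f g : EuclideanSpace ℝ (Fin d) → ℝ} (hf : DifferentiableAt ℝ f x)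
    (hg : DifferentiableAt ℝ g x) :
    partialDeriv k (fun y => f y * g y) x =
      f x * partialDeriv k g x + g x * partialDeriv k f x := by
  simp only [partialDeriv]
  rw [fderiv_fun_mul hf hg]
  simp

theorem partialDeriv_comp {f : ℝ → ℝ} {f' : ℝ} {g : EuclideanSpace ℝ (Fin d) → ℝ}
    (hf : HasDerivAt f f' (g x)) (hg : DifferentiableAt ℝ g x) :
    partialDeriv k (fun y => f (g y)) x = f' * partialDeriv k g x := by
  simp only [partialDeriv]
  have h : HasFDerivAt (fun y => f (g y)) (f' • fderiv ℝ g x) x :=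
    hf.comp_hasFDerivAt x hg.hasFDerivAt
  rw [h.fderiv]
  simp

theorem contDiff_coord {n : WithTop ℕ∞} :
    ContDiff ℝ n (fun y : EuclideanSpace ℝ (Fin d) => y k) :=
  (EuclideanSpace.proj (𝕜 := ℝ) k).contDiff

theorem partialDeriv_coord : partialDeriv k (fun y => y k) x = 1 := by
  have h : HasFDerivAt (fun y : EuclideanSpace ℝ (Fin d) => y k)
    (EuclideanSpace.proj (𝕜 := ℝ) k : EuclideanSpace ℝ (Fin d) →L[ℝ] ℝ) x :=
    (EuclideanSpace.proj (𝕜 := ℝ) k).hasFDerivAt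
  rw [partialDeriv, h.fderiv]
  simp

theorem sum_sq_coord (x : EuclideanSpace ℝ (Fin d)) : ∑ k, x k ^ 2 = ‖x‖ ^ 2 := by
  simp [EuclideanSpace.norm_sq_eq]

theorem contDiff_partialDeriv {f : EuclideanSpace ℝ (Fin d) → ℝ} {n m : WithTop ℕ∞}
    (hf : ContDiff ℝ n f) (h : m + 1 ≤ n) : ContDiff ℝ m (partialDeriv k f) :=
  (hf.fderiv_right h).clm_apply contDiff_const

theorem support_partialDeriv_subset (f : EuclideanSpace ℝ (Fin d) → ℝ) :
    Function.support (partialDeriv k f) ⊆ tsupport f := by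
  intro x hx
  refine support_fderiv_subset ℝ (f := f) fun h => hx ?_
  simp [partialDeriv, h]

theorem tsupport_partialDeriv_subset (f : EuclideanSpace ℝ (Fin d) → ℝ) :
    tsupport (partialDeriv k f) ⊆ tsupport f :=
  closure_minimal (support_partialDeriv_subset k f) (isClosed_tsupport f)

/-- Integration by parts against the constant function 1. -/
theorem integral_partialDeriv_eq_zero {f : EuclideanSpace ℝ (Fin d) → ℝ}
    (hf : ContDiff ℝ 1 f) (hc : HasCompactSupport f) : ∫ x, partialDeriv k f x = 0 := by
  have hi : Integrable (fun x => (fderiv ℝ f x) (EuclideanSpace.single k (1 : ℝ))) :=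
    ((contDiff_partialDeriv k hf (m := 0) (by norm_num)).continuous).integrable_of_hasCompactSupport
      (hc.mono' (support_partialDeriv_subset k f))
  have := integral_mul_fderiv_eq_neg_fderiv_mul_of_integrable (μ := volume)
    (f := fun _ : EuclideanSpace ℝ (Fin d) => (1 : ℝ)) (g := f)
    (v := EuclideanSpace.single k (1 : ℝ)) (by simp) (by simpa using hi)
    (by simpa using hf.continuous.integrable_of_hasCompactSupport hc) (by fun_prop)
    (fun x _ => hf.differentiable (by norm_num) x)
  simpa [partialDeriv] using this

end Calculus

/-- The pointwise estimate behind the Rellich inequality. -/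
theorem rellich_pointwise {p δ D t e r g N h : ℝ} (hp : 1 < p) (he : 0 < e)
    (hr : 0 < r) (hD : 0 < D + p * δ - 2 * p) (hD0 : 0 < D) (hg : g ^ 2 ≤ r ^ 2 * N) :
    ((p - 1) * D * (D + p * δ - 2 * p) / p ^ 2) / p * (r ^ (p * (δ - 2)) * |t| ^ p) ≤
      ((p - 1) * D * (D + p * δ - 2 * p) / p ^ 2) ^ (1 - p) / p * |h| ^ p
      + (2 * (p - 1) * (D + p * δ - 2 * p) / p - (δ - 2) * (p - 1)) * (D + p * δ - 2 * p) / p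
        * e ^ (p / 2) * r ^ (p * (δ - 2))
      + (-h * ((t ^ 2 + e) ^ (p / 2 - 1) * t * r ^ ((δ - 2) * (p - 1)))
          + r ^ (p * (δ - 2)) * r ^ 2
            * ((t ^ 2 + e) ^ (p / 2 - 2) * ((p - 1) * t ^ 2 + e)) * N
          + (δ - 2) * (p - 1) * r ^ (p * (δ - 2)) * ((t ^ 2 + e) ^ (p / 2 - 1) * t) * g)
      + (2 * (p - 1) * (D + p * δ - 2 * p) / p - (δ - 2) * (p - 1))
        * (r ^ (p * (δ - 2)) * ((t ^ 2 + e) ^ (p / 2 - 1) * t) * g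
          + (D + p * δ - 2 * p) * (((t ^ 2 + e) ^ (p / 2) - e ^ (p / 2)) / p)
            * r ^ (p * (δ - 2))) := by
  have hp0 : 0 < p := by linarith
  have hp1 : 0 < p - 1 := by linarith
  set A := D + p * δ - 2 * p with hA
  set C := (p - 1) * D * A / p ^ 2 with hC
  have hCpos : 0 < C := by positivity
  set T := t ^ 2 + e with hT
  have hTpos : 0 < T := by positivity
  set R := r ^ (p * (δ - 2)) with hR
  have hRpos : 0 < R := by positivity
  set Z := T ^ (p / 2 - 2) with hZ
  have hZpos : 0 < Z := by positivity
  have hT1 : T ^ (p / 2 - 1) = Z * T := by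
    rw [hZ, ← Real.rpow_add_one hTpos.ne']; ring_nf
  have hT2 : T ^ (p / 2) = Z * T ^ 2 := by
    rw [hZ, ← Real.rpow_natCast, ← Real.rpow_add hTpos]; norm_num
  have htM : |t| ^ p ≤ Z * T ^ 2 := by
    rw [← hT2]
    have : |t| ^ p = (t ^ 2) ^ (p / 2) := by
      rw [← sq_abs, ← Real.rpow_natCast, ← Real.rpow_mul (abs_nonneg t)]
      congr 1; push_cast; ring
    rw [this]
    exact Real.rpow_le_rpow (sq_nonneg t) (by linarith) (by positivity)
  -- The factors C^(±1/q) make Young sharp at |h|^p = C^p R T^(p/2), which the extremal satisfies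
  -- when e = 0. The cost C(1-1/p) leaves C/p of the constant C produced by the square below.
  have young : h * (Z * T * t * r ^ ((δ - 2) * (p - 1))) ≤
      C ^ (1 - p) / p * |h| ^ p + C * (1 - 1 / p) * (R * (Z * T ^ 2)) := by
    set q := p / (p - 1) with hq
    have hpq : p.HolderConjugate q := Real.HolderConjugate.conjExponent hp
    have hq0 : 0 < q := by positivity
    have hB : |Z * T * t * r ^ ((δ - 2) * (p - 1))| ≤ (R * (Z * T ^ 2)) ^ (1 / q) := by
      rw [abs_mul, abs_mul, abs_of_pos (show 0 < r ^ ((δ - 2) * (p - 1)) by positivity),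
        ← hT1, ← hT2, abs_of_pos (show 0 < T ^ (p / 2 - 1) by positivity),
        Real.mul_rpow hRpos.le (by positivity), hR, ← Real.rpow_mul hr.le,
        ← Real.rpow_mul hTpos.le]
      have e1 : p * (δ - 2) * (1 / q) = (δ - 2) * (p - 1) := by rw [hq]; field_simp
      have e2 : p / 2 * (1 / q) = p / 2 - 1 + 1 / 2 := by rw [hq]; field_simp; ring
      rw [e1, e2, Real.rpow_add hTpos, mul_comm]
      gcongr
      -- What remains is |t| ≤ T^(1/2).
      rw [← Real.sqrt_eq_rpow]
      exact Real.abs_le_sqrt (by linarith)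
    have hCq : C ^ (1 / q) * C ^ (-(1 / q)) = 1 := by
      rw [← Real.rpow_add hCpos]; simp
    calc h * (Z * T * t * r ^ ((δ - 2) * (p - 1)))
        ≤ |h| * |Z * T * t * r ^ ((δ - 2) * (p - 1))| := by
          rw [← abs_mul]; exact le_abs_self _
      _ ≤ |h| * (R * (Z * T ^ 2)) ^ (1 / q) := by gcongr
      _ = (|h| * C ^ (-(1 / q))) * (C ^ (1 / q) * (R * (Z * T ^ 2)) ^ (1 / q)) := by
          linear_combination (-|h| * (R * (Z * T ^ 2)) ^ (1 / q)) * hCq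
      _ ≤ (|h| * C ^ (-(1 / q))) ^ p / p
            + (C ^ (1 / q) * (R * (Z * T ^ 2)) ^ (1 / q)) ^ q / q :=
          Real.young_inequality_of_nonneg (by positivity) (by positivity) hpq
      _ = C ^ (1 - p) / p * |h| ^ p + C * (1 - 1 / p) * (R * (Z * T ^ 2)) := by
          rw [← Real.mul_rpow hCpos.le (by positivity), ← Real.rpow_mul (by positivity),
            Real.mul_rpow (abs_nonneg h) (by positivity), ← Real.rpow_mul hCpos.le,
            one_div_mul_cancel hq0.ne', Real.rpow_one,
            show -(1 / q) * p = 1 - p by rw [hq]; field_simp; ring,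
            show 1 - 1 / p = 1 / q by rw [hq]; field_simp]
          ring
  -- At e = 0 the square vanishes on the extremal, where g = -(A/p)t.
  have hquad : 0 ≤ R * Z * ((p - 1) * (t * g + A / p * T) ^ 2 + e * g ^ 2) := by positivity
  have hcs : 0 ≤ R * Z * ((p - 1) * t ^ 2 + e) * (r ^ 2 * N - g ^ 2) := by
    have := sub_nonneg.2 hg
    positivity
  have hC' : C / p * (R * |t| ^ p) ≤ C / p * (R * (Z * T ^ 2)) := by gcongr
  rw [hT1, hT2]
  refine hC'.trans ?_
  -- The multiplier 2(p-1)A/p - (δ-2)(p-1) of the second divergence makes the cross term T·t·g match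
  -- that square; C is the coefficient of T² left over.
  have key : C = (2 * (p - 1) * A / p - (δ - 2) * (p - 1)) * A / p - (p - 1) * A ^ 2 / p ^ 2 := by
    rw [hC, show D = A - p * δ + 2 * p by rw [hA]; ring]; field_simp; ring
  have fin : C / p * (R * (Z * T ^ 2)) = C * (R * (Z * T ^ 2))
      - C * (1 - 1 / p) * (R * (Z * T ^ 2)) := by ring
  have fin2 : C * (R * (Z * T ^ 2)) =
      ((2 * (p - 1) * A / p - (δ - 2) * (p - 1)) * A / p - (p - 1) * A ^ 2 / p ^ 2)
        * (R * (Z * T ^ 2)) := by rw [← key]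
  rw [fin, fin2]
  clear_value C R Z T
  have expand : (p - 1) * (t * g + A / p * T) ^ 2 = (p - 1) * t ^ 2 * g ^ 2
      + 2 * (p - 1) * A / p * (T * t * g) + (p - 1) * A ^ 2 / p ^ 2 * T ^ 2 := by
    field_simp; ring
  rw [expand] at hquad
  linear_combination young + hquad + hcs

/-! ### The Rellich inequality with constant C^p -/

section LowerBound

variable {d : ℕ} {φ : EuclideanSpace ℝ (Fin d) → ℝ}

/-- The singularity of the power is harmless because f vanishes near the origin. -/
theorem contDiff_norm_rpow_mul {f : EuclideanSpace ℝ (Fin d) → ℝ} {n : WithTop ℕ∞}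
    (hf : ContDiff ℝ n f) (h0 : (0 : EuclideanSpace ℝ (Fin d)) ∉ tsupport f) (a : ℝ) :
    ContDiff ℝ n (fun y => ‖y‖ ^ a * f y) := by
  refine contDiff_iff_contDiffAt.2 fun x => ?_
  by_cases hx : x ∈ tsupport f
  · exact (contDiffAt_norm_rpow (fun h => h0 (h ▸ hx)) a).mul hf.contDiffAt
  · refine contDiffAt_const (c := (0 : ℝ)) |>.congr_of_eventuallyEq ?_
    filter_upwards [notMem_tsupport_iff_eventuallyEq.1 hx] with y hy
    simp [hy]

theorem continuous_norm_rpow_mul {f : EuclideanSpace ℝ (Fin d) → ℝ}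
    (hf : Continuous f) (h0 : (0 : EuclideanSpace ℝ (Fin d)) ∉ tsupport f) (a : ℝ) :
    Continuous (fun y => ‖y‖ ^ a * f y) :=
  contDiff_zero.1 (contDiff_norm_rpow_mul (contDiff_zero.2 hf) h0 a)

theorem tsupport_subset_of_eq_zero {f g : EuclideanSpace ℝ (Fin d) → ℝ}
    (h : ∀ x, f x = 0 → g x = 0) : tsupport g ⊆ tsupport f :=
  closure_mono fun x hx hfx => hx (h x hfx)

theorem zero_notMem_tsupport (hφ : φ ∈ TestFunctions {0}ᶜ) :
    (0 : EuclideanSpace ℝ (Fin d)) ∉ tsupport φ := fun h => hφ.2.2 h rfl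

theorem contDiff_flux (hφ : φ ∈ TestFunctions {0}ᶜ) (δ : ℝ) (k : Fin d) :
    ContDiff ℝ 1 (fun y => ‖y‖ ^ δ * partialDeriv k φ y) :=
  contDiff_norm_rpow_mul (contDiff_partialDeriv k hφ.1 (by norm_num))
    (fun h => zero_notMem_tsupport hφ (tsupport_partialDeriv_subset k φ h)) δ

theorem tsupport_flux_subset (δ : ℝ) (k : Fin d) :
    tsupport (fun y => ‖y‖ ^ δ * partialDeriv k φ y) ⊆ tsupport φ :=
  tsupport_mul_subset_right.trans (tsupport_partialDeriv_subset k φ)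

theorem continuous_weightedOp (hφ : φ ∈ TestFunctions {0}ᶜ) (δ : ℝ) :
    Continuous (weightedOp {0}ᶜ δ δ φ) := by
  have : weightedOp {0}ᶜ δ δ φ = fun x =>
      -∑ k, partialDeriv k (fun y => ‖y‖ ^ δ * partialDeriv k φ y) x :=
    funext (weightedOp_compl_zero δ φ)
  rw [this]
  exact (continuous_finsetSum _ fun k _ =>
    (contDiff_partialDeriv k (contDiff_flux hφ δ k) (m := 0) (by norm_num)).continuous).neg

theorem weightedOp_eq_zero {δ : ℝ} {x : EuclideanSpace ℝ (Fin d)} (hx : x ∉ tsupport φ) :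
    weightedOp {0}ᶜ δ δ φ x = 0 := by
  rw [weightedOp_compl_zero, Finset.sum_eq_zero, neg_zero]
  intro k _
  by_contra h
  exact hx (tsupport_flux_subset δ k (support_partialDeriv_subset k _ h))

theorem hasDerivAt_regularized_power {p e : ℝ} (he : 0 < e) (t : ℝ) :
    HasDerivAt (fun t : ℝ => (t ^ 2 + e) ^ (p / 2 - 1) * t)
      ((t ^ 2 + e) ^ (p / 2 - 2) * ((p - 1) * t ^ 2 + e)) t := by
  have hT : 0 < t ^ 2 + e := by positivity
  have h := ((((hasDerivAt_id t).pow 2).add_const e).rpow_const (p := p / 2 - 1)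
    (Or.inl hT.ne')).mul (hasDerivAt_id t)
  refine h.congr_deriv ?_
  have : (t ^ 2 + e) ^ (p / 2 - 1) = (t ^ 2 + e) ^ (p / 2 - 2) * (t ^ 2 + e) := by
    rw [← Real.rpow_add_one hT.ne']; ring_nf
  simp only [id, Pi.pow_apply, this, show p / 2 - 1 - 1 = p / 2 - 2 by ring]
  push_cast; ring

/-- Subtracting e^(p/2) makes the primitive vanish at t = 0, so its composition with φ stays
supported in the support of φ. -/
theorem hasDerivAt_regularized_primitive {p e : ℝ} (hp : p ≠ 0) (he : 0 < e) (t : ℝ) :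
    HasDerivAt (fun t : ℝ => ((t ^ 2 + e) ^ (p / 2) - e ^ (p / 2)) / p)
      ((t ^ 2 + e) ^ (p / 2 - 1) * t) t := by
  have hT : 0 < t ^ 2 + e := by positivity
  have h := (((((hasDerivAt_id t).pow 2).add_const e).rpow_const (p := p / 2)
    (Or.inl hT.ne')).sub_const (e ^ (p / 2))).div_const p
  refine h.congr_deriv ?_
  simp only [id, Pi.pow_apply]
  field_simp
  push_cast; ring

theorem contDiff_rpow_sq_add {e : ℝ} (he : 0 < e) (q : ℝ) {n : WithTop ℕ∞} :
    ContDiff ℝ n (fun t : ℝ => (t ^ 2 + e) ^ q) :=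
  ((contDiff_id.pow 2).add contDiff_const).rpow_const_of_ne
    fun t => (show 0 < t ^ 2 + e by positivity).ne'

theorem hasCompactSupport_of_tsupport_subset {f : EuclideanSpace ℝ (Fin d) → ℝ}
    (hc : HasCompactSupport φ) (h : tsupport f ⊆ tsupport φ) : HasCompactSupport f :=
  hc.mono' ((subset_tsupport f).trans h)

/-- The pointwise estimate is integrated; both divergences drop out. The last term is the price of
the regularization. Its integrand does not vanish off the support of φ, hence the restriction to
that compact set. -/
theorem rellich_regularized {p δ e : ℝ} (hp : 1 < p) (hd : 0 < (d : ℝ) + p * δ - 2 * p)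
    (hd0 : 0 < (d : ℝ)) (he : 0 < e) (hφ : φ ∈ TestFunctions {0}ᶜ) :
    ((p - 1) * d * (d + p * δ - 2 * p) / p ^ 2) / p * ∫ x, ‖x‖ ^ (p * (δ - 2)) * |φ x| ^ p ≤
      ((p - 1) * d * (d + p * δ - 2 * p) / p ^ 2) ^ (1 - p) / p
          * (∫ x, |weightedOp {0}ᶜ δ δ φ x| ^ p)
      + (2 * (p - 1) * (d + p * δ - 2 * p) / p - (δ - 2) * (p - 1)) * (d + p * δ - 2 * p) / p
        * e ^ (p / 2) * ∫ x in tsupport φ, ‖x‖ ^ (p * (δ - 2)) := by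
  have hp0 : 0 < p := by linarith
  have h0 := zero_notMem_tsupport hφ
  set A : ℝ := d + p * δ - 2 * p with hA
  set S := tsupport φ with hS
  have hSc : IsCompact S := hφ.2.1
  have hSm : MeasurableSet S := hSc.measurableSet
  set ψ : ℝ → ℝ := fun t => (t ^ 2 + e) ^ (p / 2 - 1) * t with hψ
  set Φ : ℝ → ℝ := fun t => ((t ^ 2 + e) ^ (p / 2) - e ^ (p / 2)) / p with hΦ
  set b : ℝ := (δ - 2) * (p - 1) with hb
  set m : ℝ := p * (δ - 2) with hm
  set B : ℝ := 2 * (p - 1) * A / p - b with hB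
  have hψC : ContDiff ℝ 1 ψ := (contDiff_rpow_sq_add he _).mul contDiff_id
  have hΦC : ContDiff ℝ 1 Φ := ((contDiff_rpow_sq_add he _).sub contDiff_const).div_const p
  have hφ1 : ContDiff ℝ 1 φ := hφ.1.of_le (by norm_num)
  set P : Fin d → EuclideanSpace ℝ (Fin d) → ℝ :=
    fun k y => ‖y‖ ^ δ * partialDeriv k φ y with hP
  -- The flux times the regularized test function: its divergence contains -Hφ times that function.
  set G : Fin d → EuclideanSpace ℝ (Fin d) → ℝ :=
    fun k y => P k y * (‖y‖ ^ b * ψ (φ y)) with hG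
  -- The radial field whose divergence supplies the cross term and the zero-order term of the
  -- square.
  set U : Fin d → EuclideanSpace ℝ (Fin d) → ℝ :=
    fun k y => ‖y‖ ^ m * (Φ (φ y) * y k) with hU
  have hGs : ∀ k, tsupport (G k) ⊆ S := fun k =>
    tsupport_subset_of_eq_zero fun x hx => by simp [hG, hψ, hx]
  have hUs' : ∀ k, tsupport (fun y => Φ (φ y) * y k) ⊆ S := fun k =>
    tsupport_subset_of_eq_zero fun x hx => by simp [hΦ, hx]
  have hUs : ∀ k, tsupport (U k) ⊆ S := fun k => tsupport_mul_subset_right.trans (hUs' k)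
  have hGC : ∀ k, ContDiff ℝ 1 (G k) := fun k => by
    have h := contDiff_norm_rpow_mul (f := fun y => P k y * ψ (φ y)) (n := 1)
      ((contDiff_flux hφ δ k).mul (hψC.comp hφ1))
      (fun h => h0 (tsupport_flux_subset δ k (tsupport_mul_subset_left h))) b
    convert h using 2
    simp only [hG]; ring
  have hUC : ∀ k, ContDiff ℝ 1 (U k) := fun k =>
    contDiff_norm_rpow_mul ((hΦC.comp hφ1).mul (contDiff_coord k)) (fun h => h0 (hUs' k h)) m
  have hcont : ∀ (V : Fin d → EuclideanSpace ℝ (Fin d) → ℝ), (∀ k, ContDiff ℝ 1 (V k)) →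
      Continuous (fun x => ∑ k, partialDeriv k (V k) x) := fun V hV =>
    continuous_finsetSum _ fun k _ =>
      (contDiff_partialDeriv k (hV k) (m := 0) (by norm_num)).continuous
  have hdiv : ∀ (V : Fin d → EuclideanSpace ℝ (Fin d) → ℝ), (∀ k, ContDiff ℝ 1 (V k)) →
      (∀ k, tsupport (V k) ⊆ S) → ∫ x in S, ∑ k, partialDeriv k (V k) x = 0 := by
    intro V hV hVs
    have hc : ∀ k, HasCompactSupport (V k) := fun k =>
      hasCompactSupport_of_tsupport_subset hφ.2.1 (hVs k)
    rw [setIntegral_eq_integral_of_forall_compl_eq_zero, integral_finsetSum]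
    · exact Finset.sum_eq_zero fun k _ => integral_partialDeriv_eq_zero k (hV k) (hc k)
    · exact fun k _ => (contDiff_partialDeriv k (hV k) (m := 0)
        (by norm_num)).continuous.integrable_of_hasCompactSupport
          ((hc k).mono' (support_partialDeriv_subset k _))
    · intro x hx
      refine Finset.sum_eq_zero fun k _ => ?_
      by_contra h
      exact hx (hVs k (support_partialDeriv_subset k _ h))
  have hpt : ∀ x ∈ S, ((p - 1) * d * A / p ^ 2) / p * (‖x‖ ^ m * |φ x| ^ p) ≤
      ((p - 1) * d * A / p ^ 2) ^ (1 - p) / p * |weightedOp {0}ᶜ δ δ φ x| ^ p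
      + B * A / p * e ^ (p / 2) * ‖x‖ ^ m + ∑ k, partialDeriv k (G k) x
      + B * ∑ k, partialDeriv k (U k) x := by
    intro x hx
    have hx0 : x ≠ 0 := fun h => h0 (h ▸ hx)
    have hr : 0 < ‖x‖ := norm_pos_iff.2 hx0
    have hdφ : DifferentiableAt ℝ φ x := hφ1.differentiable (by norm_num) x
    have hdn : ∀ a : ℝ, DifferentiableAt ℝ (fun y : EuclideanSpace ℝ (Fin d) => ‖y‖ ^ a) x :=
      fun a => (hasFDerivAt_norm_rpow_of_ne_zero hx0 a).differentiableAt
    have hdψ : DifferentiableAt ℝ (fun y => ψ (φ y)) x :=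
      (hψC.comp hφ1).differentiable (by norm_num) x
    have hdΦ : DifferentiableAt ℝ (fun y => Φ (φ y)) x :=
      (hΦC.comp hφ1).differentiable (by norm_num) x
    have hmb : ‖x‖ ^ m = ‖x‖ ^ δ * ‖x‖ ^ (b - 2) := by
      rw [← Real.rpow_add hr]; congr 1; rw [hm, hb]; ring
    have hmb2 : ‖x‖ ^ b = ‖x‖ ^ (b - 2) * ‖x‖ ^ 2 := by
      rw [← Real.rpow_natCast, ← Real.rpow_add hr]; congr 1; push_cast; ring
    have hm2 : ‖x‖ ^ m = ‖x‖ ^ (m - 2) * ‖x‖ ^ 2 := by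
      rw [← Real.rpow_natCast, ← Real.rpow_add hr]; congr 1; push_cast; ring
    set ψ' : ℝ := (φ x ^ 2 + e) ^ (p / 2 - 2) * ((p - 1) * φ x ^ 2 + e) with hψ'
    set g : ℝ := ∑ k, x k * partialDeriv k φ x with hg
    set N : ℝ := ∑ k, partialDeriv k φ x ^ 2 with hN
    have hGx : ∑ k, partialDeriv k (G k) x =
        -weightedOp {0}ᶜ δ δ φ x * (ψ (φ x) * ‖x‖ ^ b) + ‖x‖ ^ m * ‖x‖ ^ 2 * ψ' * N
          + b * ‖x‖ ^ m * ψ (φ x) * g := by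
      have h1 : ∀ k, partialDeriv k (G k) x =
          partialDeriv k (P k) x * (ψ (φ x) * ‖x‖ ^ b)
          + ‖x‖ ^ m * ‖x‖ ^ 2 * ψ' * partialDeriv k φ x ^ 2
          + b * ‖x‖ ^ m * ψ (φ x) * (x k * partialDeriv k φ x) := by
        intro k
        rw [hG, partialDeriv_mul k ((contDiff_flux hφ δ k).differentiable (by norm_num) x)
            ((hdn b).fun_mul hdψ), partialDeriv_mul k (hdn b) hdψ,
          partialDeriv_comp k (hasDerivAt_regularized_power he (φ x)) hdφ,
          partialDeriv_norm_rpow k hx0, hmb, hmb2]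
        simp only [hP]
        ring
      rw [Finset.sum_congr rfl fun k _ => h1 k, Finset.sum_add_distrib, Finset.sum_add_distrib,
        ← Finset.sum_mul, ← Finset.mul_sum, ← Finset.mul_sum, weightedOp_compl_zero, neg_neg]
    have hUx : ∑ k, partialDeriv k (U k) x =
        ‖x‖ ^ m * ψ (φ x) * g + A * Φ (φ x) * ‖x‖ ^ m := by
      have h1 : ∀ k, partialDeriv k (U k) x =
          ‖x‖ ^ m * ψ (φ x) * (x k * partialDeriv k φ x)
          + (Φ (φ x) * m * ‖x‖ ^ (m - 2)) * x k ^ 2 + ‖x‖ ^ m * Φ (φ x) := by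
        intro k
        rw [hU, partialDeriv_mul k (hdn m)
            (hdΦ.fun_mul ((contDiff_coord k (n := 1)).differentiable (by norm_num) x)),
          partialDeriv_mul k hdΦ ((contDiff_coord k (n := 1)).differentiable (by norm_num) x),
          partialDeriv_comp k (hasDerivAt_regularized_primitive hp0.ne' he (φ x)) hdφ,
          partialDeriv_norm_rpow k hx0, partialDeriv_coord]
        ring
      rw [Finset.sum_congr rfl fun k _ => h1 k, Finset.sum_add_distrib, Finset.sum_add_distrib,
        ← Finset.mul_sum, ← Finset.mul_sum, sum_sq_coord, hm2, hA]
      simp only [Finset.sum_const, Finset.card_univ, Fintype.card_fin, nsmul_eq_mul, hm]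
      ring
    have hgN : g ^ 2 ≤ ‖x‖ ^ 2 * N := by
      rw [← sum_sq_coord]; exact Finset.sum_mul_sq_le_sq_mul_sq _ _ _
    have := rellich_pointwise (t := φ x) (h := weightedOp {0}ᶜ δ δ φ x) hp he hr hd hd0 hgN
    rw [hGx, hUx]
    linear_combination this
  have hmc : ContinuousOn (fun x : EuclideanSpace ℝ (Fin d) => ‖x‖ ^ m) S := fun x hx =>
    (contDiffAt_norm_rpow (n := 0) (fun h => h0 (h ▸ hx)) m).continuousAt.continuousWithinAt
  have hHc : Continuous fun x => |weightedOp {0}ᶜ δ δ φ x| ^ p :=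
    (continuous_weightedOp hφ δ).abs.rpow_const fun _ => Or.inr hp0.le
  have hφc : Continuous fun x => |φ x| ^ p := hφ.1.continuous.abs.rpow_const fun _ => Or.inr hp0.le
  have hi1 : IntegrableOn (fun x => ‖x‖ ^ m * |φ x| ^ p) S :=
    (hmc.mul hφc.continuousOn).integrableOn_compact hSc
  have hi2 : IntegrableOn (fun x => |weightedOp {0}ᶜ δ δ φ x| ^ p) S :=
    hHc.continuousOn.integrableOn_compact hSc
  have hi3 : IntegrableOn (fun x : EuclideanSpace ℝ (Fin d) => ‖x‖ ^ m) S :=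
    hmc.integrableOn_compact hSc
  have hi4 := (hcont G hGC).continuousOn.integrableOn_compact (μ := volume) hSc
  have hi5 := (hcont U hUC).continuousOn.integrableOn_compact (μ := volume) hSc
  have hle := setIntegral_mono_on (hi1.const_mul _)
    ((((hi2.const_mul _).add (hi3.const_mul _)).add hi4).add (hi5.const_mul _)) hSm hpt
  rw [integral_add' (((hi2.const_mul _).add (hi3.const_mul _)).add hi4) (hi5.const_mul _),
    integral_add' ((hi2.const_mul _).add (hi3.const_mul _)) hi4,
    integral_add' (hi2.const_mul _) (hi3.const_mul _), integral_const_mul, integral_const_mul,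
    integral_const_mul, integral_const_mul, hdiv G hGC hGs, hdiv U hUC hUs,
    setIntegral_eq_integral_of_forall_compl_eq_zero,
    setIntegral_eq_integral_of_forall_compl_eq_zero (f := fun x => |weightedOp _ _ _ _ x| ^ p)]
    at hle
  · simpa using hle
  · intro x hx
    rw [weightedOp_eq_zero hx, abs_zero, Real.zero_rpow hp0.ne']
  · intro x hx
    rw [image_eq_zero_of_notMem_tsupport hx, abs_zero, Real.zero_rpow hp0.ne', mul_zero]

theorem rellich_inequality {p δ : ℝ} (hp : 1 < p) (hd : 0 < (d : ℝ) + p * δ - 2 * p)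
    (hd0 : 0 < (d : ℝ)) (hφ : φ ∈ TestFunctions {0}ᶜ) :
    ((p - 1) * d * (d + p * δ - 2 * p) / p ^ 2) ^ p * ∫ x, ‖x‖ ^ (p * (δ - 2)) * |φ x| ^ p ≤
      ∫ x, |weightedOp {0}ᶜ δ δ φ x| ^ p := by
  have hp0 : 0 < p := by linarith
  have hp1 : 0 < p - 1 := by linarith
  set C := (p - 1) * d * (d + p * δ - 2 * p) / p ^ 2 with hC
  have hCpos : 0 < C := by positivity
  have hlim : Filter.Tendsto (fun e : ℝ => e ^ (p / 2)) (nhdsWithin 0 (Set.Ioi 0)) (nhds 0) := by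
    have := (Real.continuousAt_rpow_const 0 (p / 2) (Or.inr (by positivity))).tendsto
    rw [Real.zero_rpow (by positivity)] at this
    exact this.mono_left nhdsWithin_le_nhds
  have h := ge_of_tendsto (((hlim.const_mul _).mul_const _).const_add _)
    (Filter.eventually_of_mem self_mem_nhdsWithin fun e he =>
      rellich_regularized hp hd hd0 he hφ)
  rw [mul_zero, zero_mul, add_zero, ← hC] at h
  -- The factor p C^(p-1) clears C^(1-p)/p on the right and turns C/p into C^p on the left.
  have h2 := mul_le_mul_of_nonneg_left h (show 0 ≤ p * C ^ (p - 1) by positivity)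
  have e1 : C ^ p = C ^ (p - 1) * C := by rw [← Real.rpow_add_one hCpos.ne']; ring_nf
  have e2 : C ^ (p - 1) * C ^ (1 - p) = 1 := by rw [← Real.rpow_add hCpos]; simp
  rw [e1]
  calc _ = p * C ^ (p - 1) * (C / p * ∫ x, ‖x‖ ^ (p * (δ - 2)) * |φ x| ^ p) := by
        field_simp
    _ ≤ _ := h2
    _ = (C ^ (p - 1) * C ^ (1 - p)) * ∫ x, |weightedOp {0}ᶜ δ δ φ x| ^ p := by field_simp
    _ = _ := by rw [e2, one_mul]

theorem integral_rellich_denominator {p : ℝ} (δ : ℝ) (hp : 0 < p) (hφ : φ 0 = 0) :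
    ∫ x in {0}ᶜ, weight {0}ᶜ δ δ x ^ p * boundaryDist {0}ᶜ x ^ (-2 * p) * |φ x| ^ p =
      ∫ x, ‖x‖ ^ (p * (δ - 2)) * |φ x| ^ p := by
  rw [← setIntegral_eq_integral_of_forall_compl_eq_zero (s := {0}ᶜ)
    (f := fun x => ‖x‖ ^ (p * (δ - 2)) * |φ x| ^ p)]
  · refine setIntegral_congr_fun (measurableSet_singleton 0).compl fun x hx => ?_
    have hr : 0 < ‖x‖ := norm_pos_iff.2 hx
    simp only [weight_compl_zero, boundaryDist_compl_zero]
    rw [← Real.rpow_mul hr.le, ← Real.rpow_add hr]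
    ring_nf
  · intro x hx
    have : x = 0 := by simpa using hx
    rw [this, hφ, abs_zero, Real.zero_rpow hp.ne', mul_zero]

theorem integral_rellich_numerator {p : ℝ} (δ : ℝ) (hp : 0 < p) (hφ : φ ∈ TestFunctions {0}ᶜ) :
    ∫ x in {0}ᶜ, |weightedOp {0}ᶜ δ δ φ x| ^ p = ∫ x, |weightedOp {0}ᶜ δ δ φ x| ^ p :=
  setIntegral_eq_integral_of_forall_compl_eq_zero fun x hx => by
    rw [weightedOp_eq_zero fun h => hx (hφ.2.2 h), abs_zero, Real.zero_rpow hp.ne']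

theorem integral_norm_rpow_mul_pos {p : ℝ} (a : ℝ) (hp : 0 < p) (hφ : φ ∈ TestFunctions {0}ᶜ)
    (hne : φ ≠ 0) : 0 < ∫ x, ‖x‖ ^ a * |φ x| ^ p := by
  obtain ⟨x, hx⟩ := Function.ne_iff.1 hne
  have hs : tsupport (fun y => |φ y| ^ p) ⊆ tsupport φ :=
    tsupport_subset_of_eq_zero fun x hx => by simp [hx, hp.ne']
  have h0 := zero_notMem_tsupport hφ
  have hx0 : x ≠ 0 := fun h => h0 (h ▸ subset_tsupport φ hx)
  have hr : 0 < ‖x‖ := norm_pos_iff.2 hx0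
  refine (continuous_norm_rpow_mul (hφ.1.continuous.abs.rpow_const fun _ => Or.inr hp.le)
    (fun h => h0 (hs h)) a).integral_pos_of_hasCompactSupport_nonneg_nonzero
    (hasCompactSupport_of_tsupport_subset hφ.2.1 (tsupport_mul_subset_right.trans hs))
    (fun y => by positivity) (x := x) ?_
  have : 0 < |φ x| := abs_pos.2 hx
  positivity

end LowerBound

/-! ### Sharpness: slowly cut off powers -/

section UpperBound

variable {d : ℕ}

theorem differentiableAt_norm_of_ne_zero {x : EuclideanSpace ℝ (Fin d)} (hx : x ≠ 0) :
    DifferentiableAt ℝ (fun y : EuclideanSpace ℝ (Fin d) => ‖y‖) x :=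
  (contDiffAt_norm ℝ hx (n := 1)).differentiableAt (by norm_num)

theorem partialDeriv_log_norm {x : EuclideanSpace ℝ (Fin d)} (hx : x ≠ 0) (k : Fin d) :
    partialDeriv k (fun y => Real.log ‖y‖) x = ‖x‖ ^ (-2 : ℝ) * x k := by
  have hr : 0 < ‖x‖ := norm_pos_iff.2 hx
  have h1 := partialDeriv_norm_rpow k hx 1
  simp only [Real.rpow_one, one_mul] at h1
  rw [partialDeriv_comp k (Real.hasDerivAt_log hr.ne') (differentiableAt_norm_of_ne_zero hx), h1,
    ← mul_assoc, ← Real.rpow_neg_one, ← Real.rpow_add hr]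
  norm_num

theorem differentiableAt_log_norm {x : EuclideanSpace ℝ (Fin d)} (hx : x ≠ 0) :
    DifferentiableAt ℝ (fun y : EuclideanSpace ℝ (Fin d) => Real.log ‖y‖) x :=
  (differentiableAt_norm_of_ne_zero hx).log (norm_ne_zero_iff.2 hx)

theorem differentiableAt_norm_rpow_mul_log {x : EuclideanSpace ℝ (Fin d)} (hx : x ≠ 0) (a : ℝ)
    {g : ℝ → ℝ} {g' : ℝ} (hg : HasDerivAt g g' (Real.log ‖x‖)) :
    DifferentiableAt ℝ (fun y : EuclideanSpace ℝ (Fin d) => ‖y‖ ^ a * g (Real.log ‖y‖)) x :=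
  (hasFDerivAt_norm_rpow_of_ne_zero hx a).differentiableAt.fun_mul
    (hg.differentiableAt.comp x (differentiableAt_log_norm hx))

theorem partialDeriv_norm_rpow_mul_log {x : EuclideanSpace ℝ (Fin d)} (hx : x ≠ 0) (a : ℝ)
    {g : ℝ → ℝ} {g' : ℝ} (hg : HasDerivAt g g' (Real.log ‖x‖)) (k : Fin d) :
    partialDeriv k (fun y => ‖y‖ ^ a * g (Real.log ‖y‖)) x =
      ‖x‖ ^ (a - 2) * (a * g (Real.log ‖x‖) + g') * x k := by
  have hr : 0 < ‖x‖ := norm_pos_iff.2 hx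
  have hdg : DifferentiableAt ℝ (fun y : EuclideanSpace ℝ (Fin d) => g (Real.log ‖y‖)) x :=
    hg.differentiableAt.comp x (differentiableAt_log_norm hx)
  rw [partialDeriv_mul k (hasFDerivAt_norm_rpow_of_ne_zero hx a).differentiableAt hdg,
    partialDeriv_comp k hg (differentiableAt_log_norm hx), partialDeriv_norm_rpow k hx,
    partialDeriv_log_norm hx, sub_eq_add_neg a 2, Real.rpow_add hr]
  ring

/-- In the variable log|x| the operator has constant coefficients once a power of |x| is factored
out. Constant g gives the eigenvalue-type relation for |x|^(-s). -/
theorem weightedOp_norm_rpow_mul_log {x : EuclideanSpace ℝ (Fin d)} (hx : x ≠ 0) (δ s : ℝ)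
    {g g₁ g₂ : ℝ → ℝ} (hg : ∀ t, HasDerivAt g (g₁ t) t) (hg₁ : ∀ t, HasDerivAt g₁ (g₂ t) t) :
    weightedOp {0}ᶜ δ δ (fun y => ‖y‖ ^ (-s) * g (Real.log ‖y‖)) x =
      ‖x‖ ^ (δ - s - 2) * (s * (d + δ - s - 2) * g (Real.log ‖x‖)
        + (s - (d + δ - s - 2)) * g₁ (Real.log ‖x‖) - g₂ (Real.log ‖x‖)) := by
  have hr : 0 < ‖x‖ := norm_pos_iff.2 hx
  set h : ℝ → ℝ := fun t => -s * g t + g₁ t with hh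
  have hh' : ∀ t, HasDerivAt h (-s * g₁ t + g₂ t) t := fun t =>
    ((hg t).const_mul (-s)).add (hg₁ t)
  have hk : ∀ k, partialDeriv k (fun y : EuclideanSpace ℝ (Fin d) => ‖y‖ ^ δ *
      partialDeriv k (fun y => ‖y‖ ^ (-s) * g (Real.log ‖y‖)) y) x =
      ‖x‖ ^ (δ - s - 2) * h (Real.log ‖x‖) + ‖x‖ ^ (δ - s - 2 - 2) *
        ((δ - s - 2) * h (Real.log ‖x‖) + (-s * g₁ (Real.log ‖x‖) + g₂ (Real.log ‖x‖)))
          * x k ^ 2 := by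
    intro k
    -- The formula for the inner derivative holds only away from 0, so the outer one is computed
    -- from the germ at x.
    have hev : (fun y : EuclideanSpace ℝ (Fin d) => ‖y‖ ^ δ *
        partialDeriv k (fun y => ‖y‖ ^ (-s) * g (Real.log ‖y‖)) y) =ᶠ[nhds x]
        fun y => (‖y‖ ^ (δ - s - 2) * h (Real.log ‖y‖)) * y k := by
      filter_upwards [isOpen_ne.mem_nhds hx] with y hy
      rw [partialDeriv_norm_rpow_mul_log hy _ (hg _), ← mul_assoc, ← mul_assoc,
        ← Real.rpow_add (norm_pos_iff.2 hy)]
      simp only [hh]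
      ring_nf
    have hcongr : ∀ {f₁ f₂ : EuclideanSpace ℝ (Fin d) → ℝ}, f₁ =ᶠ[nhds x] f₂ →
        partialDeriv k f₁ x = partialDeriv k f₂ x := fun he => by
      simp only [partialDeriv, he.fderiv_eq]
    rw [hcongr hev, partialDeriv_mul k (differentiableAt_norm_rpow_mul_log hx _ (hh' _))
      ((contDiff_coord k (n := 1)).differentiable (by norm_num) x),
      partialDeriv_norm_rpow_mul_log hx _ (hh' _), partialDeriv_coord]
    ring
  have hp2 : ‖x‖ ^ (δ - s - 2) = ‖x‖ ^ (δ - s - 2 - 2) * ‖x‖ ^ 2 := by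
    rw [← Real.rpow_natCast, ← Real.rpow_add hr]; congr 1; push_cast; ring
  rw [weightedOp_compl_zero, Finset.sum_congr rfl fun k _ => hk k, Finset.sum_add_distrib,
    ← Finset.mul_sum (s := Finset.univ) (f := fun k => x k ^ 2), sum_sq_coord, hp2]
  simp only [Finset.sum_const, Finset.card_univ, Fintype.card_fin, nsmul_eq_mul, hh]
  ring

/-- Bounded log|x| confines the support to an annulus. At the origin log 0 = 0 by convention, so g
gives no vanishing there; s ≠ 0 does, through 0^(-s) = 0. -/
theorem norm_rpow_mul_log_mem_testFunctions {s : ℝ} (hs : s ≠ 0) {g : ℝ → ℝ}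
    (hg : ContDiff ℝ 2 g) (hc : HasCompactSupport g) :
    (fun y : EuclideanSpace ℝ (Fin d) => ‖y‖ ^ (-s) * g (Real.log ‖y‖)) ∈
      TestFunctions {0}ᶜ := by
  obtain ⟨R, hR⟩ := hc.isCompact.isBounded.subset_closedBall 0
  set φ : EuclideanSpace ℝ (Fin d) → ℝ := fun y => ‖y‖ ^ (-s) * g (Real.log ‖y‖) with hφ
  set K : Set (EuclideanSpace ℝ (Fin d)) := {x | Real.exp (-R) ≤ ‖x‖ ∧ ‖x‖ ≤ Real.exp R} with hK
  have hKc : IsClosed K :=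
    (isClosed_le continuous_const continuous_norm).inter
      (isClosed_le continuous_norm continuous_const)
  have hK0 : (0 : EuclideanSpace ℝ (Fin d)) ∉ K := fun h => by
    have := h.1
    rw [norm_zero] at this
    exact absurd this (not_le.2 (Real.exp_pos _))
  have hKcomp : IsCompact K := (isCompact_closedBall (0 : EuclideanSpace ℝ (Fin d))
    (Real.exp R)).of_isClosed_subset hKc fun x hx => by simpa using hx.2
  have hsupp : Function.support φ ⊆ K := by
    intro x hx
    have hx0 : x ≠ 0 := by
      rintro rfl
      exact hx (by simp [hφ, Real.zero_rpow (neg_ne_zero.2 hs)])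
    have hr : 0 < ‖x‖ := norm_pos_iff.2 hx0
    have hgx : g (Real.log ‖x‖) ≠ 0 := fun h => hx (by simp [hφ, h])
    have := hR (subset_tsupport g hgx)
    rw [mem_closedBall_zero_iff, Real.norm_eq_abs, abs_le] at this
    exact ⟨(Real.le_log_iff_exp_le hr).1 this.1, (Real.log_le_iff_le_exp hr).1 this.2⟩
  have htsupp : tsupport φ ⊆ K := closure_minimal hsupp hKc
  refine ⟨contDiff_iff_contDiffAt.2 fun x => ?_,
    hKcomp.of_isClosed_subset (isClosed_tsupport φ) htsupp, fun x hx h => ?_⟩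
  · by_cases hx : x = 0
    · refine (contDiffAt_const (c := (0 : ℝ))).congr_of_eventuallyEq ?_
      filter_upwards [hKc.isOpen_compl.mem_nhds (hx ▸ hK0)] with y hy
      exact Function.notMem_support.1 fun h => hy (hsupp h)
    · exact (contDiffAt_norm_rpow hx _).mul
        (hg.contDiffAt.comp x ((contDiffAt_norm ℝ hx).log (norm_ne_zero_iff.2 hx)))
  · rw [Set.mem_singleton_iff.1 h] at hx
    exact hK0 (htsupp hx)

theorem setIntegral_Ioi_inv_mul_comp_log (F : ℝ → ℝ) :
    ∫ y in Set.Ioi (0 : ℝ), y⁻¹ * F (Real.log y) = ∫ t, F t := by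
  have h := integral_image_eq_integral_abs_deriv_smul (s := Set.univ) MeasurableSet.univ
    (fun t _ => (Real.hasDerivAt_exp t).hasDerivWithinAt) Real.exp_injective.injOn
    (fun y => y⁻¹ * F (Real.log y))
  rw [Set.image_univ, Real.range_exp] at h
  rw [h, setIntegral_univ]
  refine integral_congr_ae (Filter.Eventually.of_forall fun t => ?_)
  simp only [Real.abs_exp, Real.log_exp, smul_eq_mul]
  rw [← mul_assoc, mul_inv_cancel₀ (Real.exp_pos t).ne', one_mul]

/-- Polar coordinates give |x|^(-d) dx = κ dr/r with κ the area of the unit sphere, and r = exp t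
gives dt. Only the positivity of κ matters, as it cancels in the quotient. -/
theorem exists_integral_norm_rpow_mul_log (hd : 0 < d) :
    ∃ κ : ℝ, 0 < κ ∧ ∀ F : ℝ → ℝ,
      ∫ x in ({0}ᶜ : Set (EuclideanSpace ℝ (Fin d))), ‖x‖ ^ (-(d : ℝ)) * F (Real.log ‖x‖) =
        κ * ∫ t, F t := by
  have : Nonempty (Fin d) := ⟨⟨0, hd⟩⟩
  have hd' : (0 : ℝ) < d := by exact_mod_cast hd
  refine ⟨d * volume.real (Metric.ball (0 : EuclideanSpace ℝ (Fin d)) 1),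
    mul_pos hd' (ENNReal.toReal_pos (Metric.measure_ball_pos _ _ one_pos).ne' measure_ball_lt_top.ne), fun F => ?_⟩
  rw [setIntegral_congr_set (ae_eq_univ.2 (by simp)), setIntegral_univ, integral_fun_norm_addHaar volume
    (fun r => r ^ (-(d : ℝ)) * F (Real.log r)), ← setIntegral_Ioi_inv_mul_comp_log,
    finrank_euclideanSpace_fin, nsmul_eq_mul, smul_eq_mul, mul_assoc]
  congr 2
  refine setIntegral_congr_fun measurableSet_Ioi fun y hy => ?_
  have hy : (0 : ℝ) < y := hy
  simp only [smul_eq_mul]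
  rw [← mul_assoc, ← Real.rpow_natCast, ← Real.rpow_add hy, ← Real.rpow_neg_one]
  congr 2
  push_cast [Nat.cast_sub (Nat.succ_le_of_lt hd)]
  ring

theorem rellichConstant_le {p δ : ℝ} (hp : 1 < p) (hd : 0 < d)
    (hA : 0 < (d : ℝ) + p * δ - 2 * p) :
    rellichConstant ({0}ᶜ : Set (EuclideanSpace ℝ (Fin d))) δ δ p ≤
      ((p - 1) * d * (d + p * δ - 2 * p) / p ^ 2) ^ p := by
  have hp0 : 0 < p := by linarith
  have hp1 : 0 < p - 1 := by linarith
  have hd' : (0 : ℝ) < d := by exact_mod_cast hd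
  set C := (p - 1) * d * (d + p * δ - 2 * p) / p ^ 2 with hC
  have hCpos : 0 < C := by positivity
  -- The critical exponent: (δ-s-2)p = -d, so numerator and denominator both carry the weight
  -- |x|^(-d).
  set s : ℝ := (d + p * δ - 2 * p) / p with hs
  have hs0 : s ≠ 0 := by positivity
  have hsC : s * (d + δ - s - 2) = C := by rw [hs, hC]; field_simp; ring
  set a : ℝ := s - (d + δ - s - 2) with ha
  obtain ⟨κ, hκ, hint⟩ := exists_integral_norm_rpow_mul_log hd
  let bump : ContDiffBump (0 : ℝ) := ⟨1, 2, one_pos, one_lt_two⟩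
  obtain ⟨η, hη, hηc, hη0⟩ : ∃ η : ℝ → ℝ, ContDiff ℝ 2 η ∧ HasCompactSupport η ∧ η 0 = 1 :=
    ⟨bump, bump.contDiff, bump.hasCompactSupport,
      bump.one_of_mem_closedBall (by simp [bump])⟩
  have hη1 : ContDiff ℝ 1 (deriv η) := (contDiff_succ_iff_deriv (n := 1)).1 hη |>.2.2
  have hη2 : Continuous (deriv (deriv η)) := hη1.continuous_deriv le_rfl
  have hd1 : ∀ t, HasDerivAt η (deriv η t) t := fun t =>
    (hη.differentiable (by norm_num) t).hasDerivAt
  have hd2 : ∀ t, HasDerivAt (deriv η) (deriv (deriv η) t) t := fun t =>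
    (hη1.differentiable (by norm_num) t).hasDerivAt
  -- The numerator density after u = ε log|x|; at ε = 0 only C η survives.
  set Q : ℝ → ℝ → ℝ := fun ε u =>
    |C * η u + a * (ε * deriv η u) - ε ^ 2 * deriv (deriv η) u| ^ p with hQ
  set I : ℝ := ∫ u, |η u| ^ p with hI
  have hIpos : 0 < I := by
    refine (hη.continuous.abs.rpow_const fun _ =>
      Or.inr hp0.le).integral_pos_of_hasCompactSupport_nonneg_nonzero
      (hηc.mono fun u hu h => hu (by simp [h, hp0.ne'])) (fun u => by positivity) (x := 0) ?_
    simp [hη0]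
  -- All integrands live on the fixed compact support of η, so continuity in ε passes through the
  -- integral.
  have hJ : Filter.Tendsto (fun ε => ∫ u, Q ε u) (nhds 0) (nhds (∫ u, Q 0 u)) := by
    have hQc : Continuous (Function.uncurry Q) := by
      refine Continuous.rpow_const ?_ fun _ => Or.inr hp0.le
      have := hη.continuous
      have := hη1.continuous
      fun_prop
    have h := continuous_parametric_integral_of_continuous (μ := volume) hQc hηc.isCompact
    have he : ∀ ε, ∫ u in tsupport η, Q ε u = ∫ u, Q ε u := fun ε => by
      refine setIntegral_eq_integral_of_forall_compl_eq_zero fun u hu => ?_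
      have h1 : deriv η u = 0 := by
        by_contra h; exact hu (support_deriv_subset h)
      have h2 : deriv (deriv η) u = 0 := by
        by_contra h
        exact hu (closure_minimal support_deriv_subset (isClosed_tsupport η)
          (support_deriv_subset h))
      simp [hQ, h1, h2, image_eq_zero_of_notMem_tsupport hu, hp0.ne']
    simp only [he] at h
    exact h.tendsto 0
  have hJ0 : ∫ u, Q 0 u = C ^ p * I := by
    rw [hI, ← integral_const_mul]
    refine integral_congr_ae (Filter.Eventually.of_forall fun u => ?_)
    simp only [hQ]
    rw [← Real.mul_rpow hCpos.le (abs_nonneg _), ← abs_of_pos hCpos, ← abs_mul, abs_of_pos hCpos]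
    simp
  have hle : ∀ ε : ℝ, 0 < ε → rellichConstant ({0}ᶜ : Set (EuclideanSpace ℝ (Fin d))) δ δ p ≤
      (∫ u, Q ε u) / I := by
    intro ε hε
    set g : ℝ → ℝ := fun t => η (ε * t) with hg
    set φ : EuclideanSpace ℝ (Fin d) → ℝ := fun y => ‖y‖ ^ (-s) * g (Real.log ‖y‖) with hφ
    have hgC : ContDiff ℝ 2 g := hη.comp (contDiff_const.mul contDiff_id)
    have hgc : HasCompactSupport g :=
      hηc.comp_homeomorph (Homeomorph.mulLeft₀ ε hε.ne')
    have hlin : ∀ t, HasDerivAt (fun t => ε * t) ε t := fun t => by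
      simpa using (hasDerivAt_id t).const_mul ε
    have hg1 : ∀ t, HasDerivAt g (ε * deriv η (ε * t)) t := fun t => by
      rw [mul_comm]
      exact (hd1 (ε * t)).comp t (hlin t)
    have hg2 : ∀ t, HasDerivAt (fun t => ε * deriv η (ε * t))
        (ε ^ 2 * deriv (deriv η) (ε * t)) t := fun t => by
      refine (((hd2 (ε * t)).comp t (hlin t)).const_mul ε).congr_deriv ?_
      ring
    have hmem : φ ∈ TestFunctions {0}ᶜ := norm_rpow_mul_log_mem_testFunctions hs0 hgC hgc
    refine csInf_le ⟨0, ?_⟩ ⟨φ, hmem, ?_, ?_⟩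
    · rintro r ⟨ψ, -, -, rfl⟩
      refine div_nonneg (integral_nonneg fun x => by positivity) (integral_nonneg fun x => ?_)
      simp only [weight_compl_zero, boundaryDist_compl_zero]
      positivity
    · intro h
      have := congrFun h (EuclideanSpace.single ⟨0, hd⟩ 1)
      simp [hφ, hg, hη0] at this
    · have hnum : ∫ x in {0}ᶜ, |weightedOp {0}ᶜ δ δ φ x| ^ p = κ * (ε⁻¹ * ∫ u, Q ε u) := by
        have := Measure.integral_comp_mul_left (Q ε) ε
        rw [abs_of_pos (inv_pos.2 hε), smul_eq_mul] at this
        rw [← this, ← hint]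
        refine setIntegral_congr_fun (measurableSet_singleton 0).compl fun x hx => ?_
        have hx : x ≠ 0 := hx
        simp only [hφ, hQ]
        rw [weightedOp_norm_rpow_mul_log hx δ s hg1 hg2, hsC, abs_mul, abs_of_nonneg (by positivity : 0 ≤ ‖x‖ ^ (δ - s - 2)),
          Real.mul_rpow (by positivity) (abs_nonneg _), ← Real.rpow_mul (norm_nonneg x),
          show (δ - s - 2) * p = -d by rw [hs]; field_simp; ring]
      have hden : ∫ x in {0}ᶜ, weight {0}ᶜ δ δ x ^ p * boundaryDist {0}ᶜ x ^ (-2 * p) * |φ x| ^ p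
          = κ * (ε⁻¹ * I) := by
        have := Measure.integral_comp_mul_left (fun u => |η u| ^ p) ε
        rw [abs_of_pos (inv_pos.2 hε), smul_eq_mul] at this
        rw [hI, ← this, ← hint]
        refine setIntegral_congr_fun (measurableSet_singleton 0).compl fun x hx => ?_
        have hr : 0 < ‖x‖ := norm_pos_iff.2 hx
        simp only [weight_compl_zero, boundaryDist_compl_zero, hφ, hg]
        rw [abs_mul, abs_of_nonneg (by positivity : 0 ≤ ‖x‖ ^ (-s)),
          Real.mul_rpow (by positivity) (abs_nonneg _), ← Real.rpow_mul hr.le,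
          ← Real.rpow_mul hr.le, ← Real.rpow_add hr, ← mul_assoc, ← Real.rpow_add hr,
          show δ * p + -2 * p + -s * p = -d by rw [hs]; field_simp; ring]
      rw [hnum, hden]
      field_simp
  have hlim : Filter.Tendsto (fun ε => (∫ u, Q ε u) / I) (nhdsWithin 0 (Set.Ioi 0))
      (nhds (C ^ p)) := by
    have := (hJ.div_const I).mono_left (nhdsWithin_le_nhds (s := Set.Ioi 0))
    rwa [hJ0, mul_div_cancel_right₀ _ hIpos.ne'] at this
  exact ge_of_tendsto hlim (Filter.eventually_of_mem self_mem_nhdsWithin hle)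

/-- Needed for the lower bound on the infimum, since the real `sInf` of the empty set is 0. -/
theorem exists_ne_zero_mem_testFunctions (hd : 0 < d) :
    ∃ φ ∈ TestFunctions ({0}ᶜ : Set (EuclideanSpace ℝ (Fin d))), φ ≠ 0 := by
  let η : ContDiffBump (0 : ℝ) := ⟨1, 2, one_pos, one_lt_two⟩
  refine ⟨_, norm_rpow_mul_log_mem_testFunctions one_ne_zero η.contDiff η.hasCompactSupport,
    fun h => ?_⟩
  have := congrFun h (EuclideanSpace.single ⟨0, hd⟩ 1)
  have h1 : η 0 = 1 := η.one_of_mem_closedBall (by simp [η])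
  simp [h1] at this

theorem le_rellichConstant {p δ : ℝ} (hp : 1 < p) (hd : 0 < d)
    (hA : 0 < (d : ℝ) + p * δ - 2 * p) :
    ((p - 1) * d * (d + p * δ - 2 * p) / p ^ 2) ^ p ≤
      rellichConstant ({0}ᶜ : Set (EuclideanSpace ℝ (Fin d))) δ δ p := by
  have hp0 : 0 < p := by linarith
  obtain ⟨φ₀, hφ₀, hne₀⟩ := exists_ne_zero_mem_testFunctions hd
  refine le_csInf ⟨_, φ₀, hφ₀, hne₀, rfl⟩ ?_
  rintro r ⟨φ, hφ, hne, rfl⟩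
  rw [integral_rellich_numerator δ hp0 hφ, integral_rellich_denominator δ hp0
    (image_eq_zero_of_notMem_tsupport (zero_notMem_tsupport hφ)),
    le_div_iff₀ (integral_norm_rpow_mul_pos _ hp0 hφ hne)]
  exact rellich_inequality hp hA (by exact_mod_cast hd) hφ

end UpperBound

theorem proposition4p6 (d : ℕ) (p δ δ' : ℝ) (hp : 1 < p) (hδ : 0 ≤ δ) (hδ2 : δ < 2)
    (hδδ' : δ = δ') (hd : 0 < (d : ℝ) + p * δ - 2 * p)
    (K Ω : Set (EuclideanSpace ℝ (Fin d))) (hK : K = {0}) (hΩ : Ω = Kᶜ) :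
    rellichConstant Ω δ δ' p
      = ((p - 1) * (d : ℝ) * ((d : ℝ) + p * δ - 2 * p) / p ^ 2) ^ p := by
  subst hδδ' hΩ hK
  -- Since δ < 2, the hypothesis gives d > p(2-δ) > 0.
  have hd0 : 0 < d := by
    have : (0 : ℝ) < d := by nlinarith
    exact_mod_cast this
  exact le_antisymm (rellichConstant_le hp hd0 hd) (le_rellichConstant hp hd0 hd)
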